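/- All graphs are finite and simple. A graph is \emph{nice} if none of its connected components is isomorphic to $K_2$. For $k\ge 1$, a \emph{$k$-edge-weighting} of a graph $G$ is a map $\omega:E(G)\to\{1,\dots,k\}$; it is \emph{neighbour sum distinguishing} if the induced vertex-colouring $\sigma_\omega(v)=\sum_{u\in N_G(v)}\omega(uv)$ satisfies $\sigma_\omega(u)\ne\sigma_\omega(v)$ for every edge $uv$ of $G$. For an integer $d\ge 0$, the weighting $\omega$ is \emph{$d$-relaxed} if every set of edges on which $\omega$ is constant induces a subgraph of maximum degree at most $d$, and $\chi'^{d}_{\sum}(G)$ denotes the smallest $k\ge 1$ for which $G$ admits a neighbour sum distinguishing $d$-relaxed $k$-edge-weighting ($\infty$ if there is none). Theorem. Let $G$ be a nice graph with maximum degree $\Delta=\Delta(G)\le 5$. Then $G$ admits a neighbour sum distinguishing $7$-edge-weighting such that every vertex of degree at least $2$ is incident with two edges of different weights. Moreover, $\chi'^{\Delta-1}_{\sum}(G)\le 7$ (where $\Delta-1$ is read as $0$ if $G$ has no edges). -/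

import Mathlib

namespace SimpleGraph

variable {V : Type*}

/-- A graph is nice if none of its connected components is isomorphic to `K₂`. -/
def IsNice (G : SimpleGraph V) : Prop :=
  ∀ C : G.ConnectedComponent, IsEmpty (C.toSimpleGraph ≃g completeGraph (Fin 2))

/-- A `k`-edge-weighting of `G`: a map from the edges of `G` to `{1, …, k}`. -/
def IsEdgeWeighting (G : SimpleGraph V) (k : ℕ) (ω : G.edgeSet → ℕ) : Prop :=
  ∀ e, ω e ∈ Set.Icc 1 k

/-- The induced vertex-colouring `σ_ω(v) = ∑_{u ∈ N(v)} ω(vu)`. -/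
def weightSum (G : SimpleGraph V) [G.LocallyFinite] (ω : G.edgeSet → ℕ) (v : V) : ℕ :=
  ∑ u : G.neighborSet v, ω ⟨s(v, (u : V)), G.mem_edgeSet.mpr u.2⟩

/-- The weighting `ω` is neighbour sum distinguishing: adjacent vertices get different sums. -/
def IsNeighbourSumDistinguishing (G : SimpleGraph V) [G.LocallyFinite]
    (ω : G.edgeSet → ℕ) : Prop :=
  ∀ u v, G.Adj u v → G.weightSum ω u ≠ G.weightSum ω v

/-- The weighting `ω` is `d`-relaxed: every monochromatic set `S` of edges induces a subgraph of
maximum degree at most `d`. -/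
def IsRelaxed (G : SimpleGraph V) [Finite V] (d : ℕ) (ω : G.edgeSet → ℕ) : Prop :=
  ∀ S : Set G.edgeSet, (∀ e ∈ S, ∀ f ∈ S, ω e = ω f) →
    ∀ v, ((fromEdgeSet ((fun e : G.edgeSet => (e : Sym2 V)) '' S)).neighborSet v).ncard ≤ d

/-- `χ'^d_∑(G)`: the smallest `k ≥ 1` such that `G` admits a neighbour sum distinguishing
`d`-relaxed `k`-edge-colouring (`⊤` if there is no such `k`). -/
noncomputable def relaxedSumIndex (G : SimpleGraph V) [Fintype V] [DecidableRel G.Adj]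
    (d : ℕ) : ℕ∞ :=
  sInf {m : ℕ∞ | ∃ k : ℕ, m = k ∧ 1 ≤ k ∧ ∃ ω : G.edgeSet → ℕ,
    G.IsEdgeWeighting k ω ∧ G.IsRelaxed d ω ∧ G.IsNeighbourSumDistinguishing ω}

end SimpleGraph

section

open Finset

/-! The components are treated separately. In one component, a core is set aside and the other
vertices are processed from the farthest to the nearest to a root `r` in the core. A vertex `v` is
settled by the weight of an edge towards a nearer neighbour `p`. That choice changes no sum settled
earlier and must avoid at most four sums of other neighbours, one weight to keep `v` non-constant,
and one weight reserved for `p`: six values out of seven (`exists_weighting_of_nearer`).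

What remains is the core, chosen by the shape of the component. If there is a leaf, it is the core:
its sum is a proper part of its neighbour's sum, because niceness gives that neighbour a second
edge. If there is a triangle, its three edges are reweighted: modulo 7 the three vertex sums
determine the three weights, so the sums can be prescribed directly (`exists_triangle_choice`).
Otherwise the minimum degree is at least two unless the component is a single vertex, and the core
is any vertex with its neighbours. These are pairwise non-adjacent, so each star edge has a list of
at least three weights good for its outer end, and an additive-combinatorial choice from the lists
separates the centre from all of them (`exists_star_choice`).

The relaxed bound follows: a weight class misses an edge at every vertex of degree at least two, and
by niceness a leaf forces the maximum degree to be at least two. -/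

theorem Finset.exists_mem_notMem_of_card_lt {α : Type*} [DecidableEq α] {s t : Finset α}
    (h : t.card < s.card) : ∃ x ∈ s, x ∉ t := by
  by_contra! hc
  exact absurd (card_le_card (fun x hx => hc x hx)) (by omega)

/-! ### Star weights from lists of size three -/

/-- Two sets of natural numbers have many sums, hence a sum avoiding few given values. -/
theorem Finset.exists_add_notMem {A B F : Finset ℕ} (hA : A.Nonempty) (hB : B.Nonempty)
    (h : F.card + 1 < A.card + B.card) : ∃ a ∈ A, ∃ b ∈ B, a + b ∉ F := by
  classical
  have h1 : A.card + B.card - 1 ≤ (A.image₂ (· + ·) B).card :=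
    cauchy_davenport_add_of_linearOrder_isCancelAdd hA hB
  obtain ⟨x, hx, hxF⟩ := exists_mem_notMem_of_card_lt (s := A.image₂ (· + ·) B) (t := F) (by omega)
  obtain ⟨a, ha, b, hb, rfl⟩ := mem_image₂.1 hx
  exact ⟨a, ha, b, hb, hxF⟩

/-- In this and the next three lemmas, the weight of a leaf's own edge cancels from its constraint,
which thus forbids one value for the sum of the other weights. Truncated subtraction is harmless: it
can only forbid extra values. -/
theorem exists_star_choice_two {A B : Finset ℕ} (hA : 3 ≤ A.card) (hB : 3 ≤ B.card) (s t : ℕ) :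
    ∃ a ∈ A, ∃ b ∈ B, a + b ≠ s + a ∧ a + b ≠ t + b ∧ a ≠ b := by
  obtain ⟨a, ha, ha'⟩ := exists_mem_notMem_of_card_lt (s := A) (t := {t}) (by simp; omega)
  obtain ⟨b, hb, hb'⟩ := exists_mem_notMem_of_card_lt (s := B) (t := {s, a})
    (card_le_two.trans_lt (by omega))
  simp only [mem_singleton, mem_insert, not_or] at ha' hb'
  exact ⟨a, ha, b, hb, by omega, by omega, by omega⟩

theorem exists_star_choice_three {A B C : Finset ℕ} (hA : 3 ≤ A.card) (hB : 3 ≤ B.card)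
    (hC : 3 ≤ C.card) (s t r : ℕ) :
    ∃ a ∈ A, ∃ b ∈ B, ∃ c ∈ C,
      a + b + c ≠ s + a ∧ a + b + c ≠ t + b ∧ a + b + c ≠ r + c ∧ b ≠ c := by
  obtain ⟨b, hb⟩ := card_pos.1 (show 0 < B.card by omega)
  obtain ⟨c, hc, hc'⟩ := exists_mem_notMem_of_card_lt (s := C) (t := {b, s - b})
    (card_le_two.trans_lt (by omega))
  obtain ⟨a, ha, ha'⟩ := exists_mem_notMem_of_card_lt (s := A) (t := {t - c, r - b})
    (card_le_two.trans_lt (by omega))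
  simp only [mem_insert, mem_singleton, not_or] at ha' hc'
  exact ⟨a, ha, b, hb, c, hc, by omega, by omega, by omega, by omega⟩

theorem exists_star_choice_four {A B C D : Finset ℕ} (hA : 3 ≤ A.card) (hB : 3 ≤ B.card)
    (hC : 3 ≤ C.card) (hD : 3 ≤ D.card) (s t r q : ℕ) :
    ∃ a ∈ A, ∃ b ∈ B, ∃ c ∈ C, ∃ d ∈ D,
      a + b + c + d ≠ s + a ∧ a + b + c + d ≠ t + b ∧ a + b + c + d ≠ r + c ∧
      a + b + c + d ≠ q + d ∧ c ≠ d := by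
  obtain ⟨c, hc⟩ := card_pos.1 (show 0 < C.card by omega)
  obtain ⟨d, hd, hd'⟩ := exists_mem_notMem_of_card_lt (s := D) (t := {c}) (by simp; omega)
  have h1 : A.card - 1 ≤ (A.erase (t - c - d)).card := pred_card_le_card_erase
  have h2 : B.card - 1 ≤ (B.erase (s - c - d)).card := pred_card_le_card_erase
  have h3 : ({r - d, q - c} : Finset ℕ).card ≤ 2 := card_le_two
  -- The erasures settle the constraints involving only one of `a`, `b`. Two lists of size two have
  -- at least three sums, and two are forbidden.
  obtain ⟨a, ha, b, hb, hab⟩ := exists_add_notMem (A := A.erase (t - c - d))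
    (B := B.erase (s - c - d)) (F := {r - d, q - c})
    (card_pos.1 (by omega)) (card_pos.1 (by omega)) (by omega)
  simp only [mem_insert, mem_singleton, not_or, mem_erase] at hab ha hb hd'
  exact ⟨a, ha.2, b, hb.2, c, hc, d, hd, by omega, by omega, by omega, by omega, by omega⟩

theorem exists_star_choice_five {A B C D E : Finset ℕ} (hA : 3 ≤ A.card) (hB : 3 ≤ B.card)
    (hC : 3 ≤ C.card) (hD : 3 ≤ D.card) (hE : 3 ≤ E.card) (s t r q p : ℕ) :
    ∃ a ∈ A, ∃ b ∈ B, ∃ c ∈ C, ∃ d ∈ D, ∃ e ∈ E,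
      a + b + c + d + e ≠ s + a ∧ a + b + c + d + e ≠ t + b ∧ a + b + c + d + e ≠ r + c ∧
      a + b + c + d + e ≠ q + d ∧ a + b + c + d + e ≠ p + e ∧ c ≠ d := by
  -- Exactly three candidates for `b`: the constraint without `a` is met for all of them at once
  -- when `c + e` is chosen, so this set must not be larger.
  obtain ⟨B', hB', hB3⟩ := exists_subset_card_eq hB
  obtain ⟨d, hd⟩ := card_pos.1 (show 0 < D.card by omega)
  have h1 : C.card - 1 ≤ (C.erase d).card := pred_card_le_card_erase
  have h2 : (B'.image fun b => s - b - d).card ≤ 3 := card_image_le.trans hB3.le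
  obtain ⟨c, hc, e, he, hce⟩ := exists_add_notMem (A := C.erase d) (B := E)
    (F := B'.image fun b => s - b - d) (card_pos.1 (by omega)) (card_pos.1 (by omega)) (by omega)
  have h3 : A.card - 1 ≤ (A.erase (t - c - d - e)).card := pred_card_le_card_erase
  have h4 : ({r - d - e, q - c - e, p - c - d} : Finset ℕ).card ≤ 3 := card_le_three
  obtain ⟨a, ha, b, hb, hab⟩ := exists_add_notMem (A := A.erase (t - c - d - e))
    (B := B') (F := {r - d - e, q - c - e, p - c - d})
    (card_pos.1 (by omega)) (card_pos.1 (by omega)) (by omega)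
  have hb' : s - b - d ≠ c + e := fun h => hce (mem_image.2 ⟨b, hb, h⟩)
  simp only [mem_insert, mem_singleton, not_or, mem_erase] at hab ha hc
  exact ⟨a, ha.2, b, hB' hb, c, hc.2, d, hd, e, he, fun h => hb' (by omega),
    fun h => ha.1 (by omega), fun h => hab.1 (by omega), fun h => hab.2.1 (by omega),
    fun h => hab.2.2 (by omega), hc.1⟩

/-- Weights for the edges of a star, chosen from lists of three values, so that the sum at the
centre differs from the sums at all leaves, and not all weights are equal. -/
theorem exists_star_choice {V : Type*} [DecidableEq V] (I : Finset V) (h2 : 2 ≤ I.card)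
    (h5 : I.card ≤ 5) (L : V → Finset ℕ) (hL : ∀ i ∈ I, 3 ≤ (L i).card) (s : V → ℕ) :
    ∃ f : V → ℕ, (∀ i ∈ I, f i ∈ L i) ∧ (∀ i ∈ I, ∑ j ∈ I, f j ≠ s i + f i) ∧
      ∃ i ∈ I, ∃ j ∈ I, f i ≠ f j := by
  obtain h | h | h | h : I.card = 2 ∨ I.card = 3 ∨ I.card = 4 ∨ I.card = 5 := by omega
  · obtain ⟨u, v, huv, rfl⟩ := card_eq_two.1 h
    simp only [mem_insert, mem_singleton, forall_eq_or_imp, forall_eq] at hL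
    obtain ⟨a, ha, b, hb, h1, h2, h3⟩ := exists_star_choice_two hL.1 hL.2 (s u) (s v)
    refine ⟨fun x => if x = u then a else b, ?_, ?_, u, by simp, v, by simp, ?_⟩ <;>
    simp [huv.symm, *] <;> omega
  · obtain ⟨u, v, x, huv, hux, hvx, rfl⟩ := card_eq_three.1 h
    simp only [mem_insert, mem_singleton, forall_eq_or_imp, forall_eq] at hL
    obtain ⟨a, ha, b, hb, c, hc, h1, h2, h3, h4⟩ :=
      exists_star_choice_three hL.1 hL.2.1 hL.2.2 (s u) (s v) (s x)
    refine ⟨fun y => if y = u then a else if y = v then b else c, ?_, ?_,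
      v, by simp, x, by simp, ?_⟩ <;>
    simp [huv.symm, hux.symm, hvx.symm, ← add_assoc, *] <;> omega
  · obtain ⟨u, v, x, y, huv, hux, huy, hvx, hvy, hxy, rfl⟩ := card_eq_four.1 h
    simp only [mem_insert, mem_singleton, forall_eq_or_imp, forall_eq] at hL
    obtain ⟨a, ha, b, hb, c, hc, d, hd, h1, h2, h3, h4, h5⟩ :=
      exists_star_choice_four hL.1 hL.2.1 hL.2.2.1 hL.2.2.2 (s u) (s v) (s x) (s y)
    refine ⟨fun z => if z = u then a else if z = v then b else if z = x then c else d, ?_, ?_,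
      x, by simp, y, by simp, ?_⟩ <;>
    simp [huv.symm, hux.symm, huy.symm, hvx.symm, hvy.symm, hxy.symm, ← add_assoc, *] <;> omega
  · obtain ⟨u, I', hu, rfl, h'⟩ := card_eq_succ.1 h
    obtain ⟨v, x, y, z, hvx, hvy, hvz, hxy, hxz, hyz, rfl⟩ := card_eq_four.1 h'
    simp only [mem_insert, mem_singleton, forall_eq_or_imp, forall_eq, not_or] at hL hu
    obtain ⟨huv, hux, huy, huz⟩ := hu
    obtain ⟨a, ha, b, hb, c, hc, d, hd, e, he, h1, h2, h3, h4, h5, h6⟩ :=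
      exists_star_choice_five hL.1 hL.2.1 hL.2.2.1 hL.2.2.2.1 hL.2.2.2.2
        (s u) (s v) (s x) (s y) (s z)
    refine ⟨fun o => if o = u then a else if o = v then b else if o = x then c else
      if o = y then d else e, ?_, ?_, x, by simp, y, by simp, ?_⟩ <;>
    simp [Ne.symm huv, Ne.symm hux, Ne.symm huy, Ne.symm huz, hvx.symm, hvy.symm, hvz.symm,
      hxy.symm, hxz.symm, hyz.symm, ← add_assoc, *] <;> omega

/-! ### Triangle weights modulo 7 -/

/-- Weights `x, y, z` (modulo 7) for the edges `ab`, `bc`, `ca` of a triangle `abc`. -/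
theorem exists_triangle_choice (A B C : ZMod 7) (Fa Fb Fc : Finset (ZMod 7)) (hFa : Fa.card ≤ 3)
    (hFb : Fb.card ≤ 4) (hFc : Fc.card ≤ 4) (p q : Prop) (h : Fa = ∅ ∨ ¬ p ∧ ¬ q) :
    ∃ x y z : ZMod 7, A + (x + z) ∉ Fa ∧ B + (x + y) ∉ Fb ∧ C + (y + z) ∉ Fc ∧
      A + (x + z) ≠ B + (x + y) ∧ A + (x + z) ≠ C + (y + z) ∧ B + (x + y) ≠ C + (y + z) ∧
      x ≠ z ∧ (p → x ≠ y) ∧ (q → y ≠ z) := by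
  have hU : (univ : Finset (ZMod 7)).card = 7 := by simp [ZMod.card]
  -- The final sums `α`, `β`, `γ` at `a`, `b`, `c` are chosen instead of the weights. Equality of
  -- two weights is a relation between two of these sums: `x = z` means `γ = β - B + C`, `x = y`
  -- means `α = γ - C + A`, and `y = z` means `α = β - B + A`.
  obtain ⟨β, -, hβ⟩ := exists_mem_notMem_of_card_lt (s := (univ : Finset (ZMod 7))) (t := Fb)
    (by omega)
  obtain ⟨γ, -, hγ⟩ := exists_mem_notMem_of_card_lt (s := (univ : Finset (ZMod 7)))
    (t := Fc ∪ {β, β - B + C}) (by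
      have h1 := card_union_le Fc {β, β - B + C}
      have h2 : ({β, β - B + C} : Finset (ZMod 7)).card ≤ 2 := card_le_two
      omega)
  obtain ⟨α, hα, hβα, hγα, hp, hq⟩ : ∃ α, α ∉ Fa ∧ α ≠ β ∧ α ≠ γ ∧ (p → α ≠ γ - C + A) ∧
      (q → α ≠ β - B + A) := by
    rcases h with rfl | ⟨hp, hq⟩
    · obtain ⟨α, -, hα⟩ := exists_mem_notMem_of_card_lt (s := (univ : Finset (ZMod 7)))
        (t := {β, γ, γ - C + A, β - B + A}) (card_le_four.trans_lt (by omega))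
      simp only [mem_insert, mem_singleton, not_or] at hα
      exact ⟨α, by simp, hα.1, hα.2.1, fun _ => hα.2.2.1, fun _ => hα.2.2.2⟩
    · obtain ⟨α, -, hα⟩ := exists_mem_notMem_of_card_lt (s := (univ : Finset (ZMod 7)))
        (t := Fa ∪ {β, γ}) (by
          have h1 := card_union_le Fa {β, γ}
          have h2 : ({β, γ} : Finset (ZMod 7)).card ≤ 2 := card_le_two
          omega)
      simp only [mem_union, mem_insert, mem_singleton, not_or] at hα
      exact ⟨α, hα.1, hα.2.1, hα.2.2, fun h => absurd h hp, fun h => absurd h hq⟩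
  simp only [mem_union, mem_insert, mem_singleton, not_or] at hγ
  -- So 4 is the inverse of 2, and the weights can be recovered from the sums.
  have h8 : (8 : ZMod 7) = 1 := by decide
  have ha : A + (4 * (α - A + (β - B) - (γ - C)) + 4 * (α - A + (γ - C) - (β - B))) = α := by
    linear_combination (α - A) * h8
  have hb : B + (4 * (α - A + (β - B) - (γ - C)) + 4 * (β - B + (γ - C) - (α - A))) = β := by
    linear_combination (β - B) * h8
  have hc : C + (4 * (β - B + (γ - C) - (α - A)) + 4 * (α - A + (γ - C) - (β - B))) = γ := by
    linear_combination (γ - C) * h8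
  refine ⟨4 * (α - A + (β - B) - (γ - C)), 4 * (β - B + (γ - C) - (α - A)),
    4 * (α - A + (γ - C) - (β - B)), ?_⟩
  rw [ha, hb, hc]
  refine ⟨hα, hβ, hγ.1, hβα, hγα, Ne.symm hγ.2.1, fun h => hγ.2.2 ?_, fun hp' h => hp hp' ?_,
    fun hq' h => hq hq' ?_⟩
  · linear_combination -h + (β - B - (γ - C)) * h8
  · linear_combination h - (α - A - (γ - C)) * h8
  · linear_combination -h - (α - A - (β - B)) * h8

/-! ### Sums of weightings and the notion of a good weighting -/

namespace SimpleGraph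

section

theorem Reachable.exists_adj_dist_lt {V : Type*} {G : SimpleGraph V} {r v : V} (h : G.Reachable v r) (hne : v ≠ r) :
    ∃ p, G.Adj v p ∧ G.dist p r < G.dist v r := by
  obtain ⟨W, hW⟩ := h.exists_walk_length_eq_dist
  cases W with
  | nil => exact absurd rfl hne
  | cons hadj W' =>
    refine ⟨_, hadj, ?_⟩
    have := dist_le W'
    rw [Walk.length_cons] at hW
    omega

variable {V : Type*} [Fintype V] (G : SimpleGraph V) [DecidableRel G.Adj]

/-- The sum of the weights of the edges at `v`, for a weighting of all unordered pairs. -/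
def pairSum (w : Sym2 V → ℕ) (v : V) : ℕ := ∑ u ∈ G.neighborFinset v, w s(v, u)

variable {G}

theorem pairSum_congr {w w' : Sym2 V → ℕ} {v : V} (h : ∀ u, G.Adj v u → w s(v, u) = w' s(v, u)) :
    G.pairSum w v = G.pairSum w' v :=
  sum_congr rfl fun u hu => h u ((G.mem_neighborFinset v u).1 hu)

theorem weightSum_eq_pairSum (w : Sym2 V → ℕ) (v : V) :
    G.weightSum (fun e => w e) v = G.pairSum w v := by
  rw [weightSum, pairSum, ← sum_coe_sort (G.neighborFinset v)]
  exact Fintype.sum_equiv (Equiv.subtypeEquivRight fun u => by simp) _ _ fun _ => rfl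

theorem exists_ne_of_two_le_degree {v : V} (h : 2 ≤ G.degree v) (p : V) :
    ∃ q, G.Adj v q ∧ q ≠ p := by
  obtain ⟨q, hq, hqp⟩ := exists_mem_ne (s := G.neighborFinset v) (by
    rw [G.card_neighborFinset_eq_degree]; omega) p
  exact ⟨q, (G.mem_neighborFinset v q).1 hq, hqp⟩

theorem exists_ne_ne_of_three_le_degree {v : V} (h : 3 ≤ G.degree v) (p q : V) :
    ∃ r, G.Adj v r ∧ r ≠ p ∧ r ≠ q := by
  classical
  obtain ⟨r, hr, hr'⟩ := exists_mem_notMem_of_card_lt (s := G.neighborFinset v) (t := {p, q}) (by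
    rw [G.card_neighborFinset_eq_degree]; exact card_le_two.trans_lt (by omega))
  simp only [mem_insert, mem_singleton, not_or] at hr'
  exact ⟨r, (G.mem_neighborFinset v r).1 hr, hr'⟩

/-- `w` is a good weighting around the vertices reachable from `r`. -/
def IsGoodOn (G : SimpleGraph V) [DecidableRel G.Adj] (r : V) (w : Sym2 V → ℕ) : Prop :=
  (∀ e, w e ∈ Icc 1 7) ∧
  (∀ u v, G.Reachable u r → G.Adj u v → G.pairSum w u ≠ G.pairSum w v) ∧
  ∀ v, G.Reachable v r → 2 ≤ G.degree v → ∃ a b, G.Adj v a ∧ G.Adj v b ∧ w s(v, a) ≠ w s(v, b)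

variable [DecidableEq V]

theorem pairSum_eq_add (w : Sym2 V → ℕ) {v p : V} (h : G.Adj v p) :
    G.pairSum w v = w s(v, p) + ∑ u ∈ (G.neighborFinset v).erase p, w s(v, u) :=
  (add_sum_erase _ (fun u => w s(v, u)) ((G.mem_neighborFinset v p).2 h)).symm

theorem pairSum_eq_add_add (w : Sym2 V → ℕ) {v p q : V} (hp : G.Adj v p) (hq : G.Adj v q)
    (hpq : p ≠ q) : G.pairSum w v =
      (w s(v, p) + w s(v, q)) + ∑ u ∈ ((G.neighborFinset v).erase p).erase q, w s(v, u) := by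
  rw [pairSum_eq_add w hp, add_assoc, add_sum_erase _ (fun u => w s(v, u))
    (mem_erase.2 ⟨hpq.symm, (G.mem_neighborFinset v q).2 hq⟩)]

/-! ### Processing vertices towards the core -/

/-- Processing the vertices of `P` from the farthest to the nearest (as measured by `d`), each
vertex fixes its sum by choosing the weight of an edge towards a nearer vertex. The vertices of
`T` keep two edges of different weights that avoid `r`. -/
theorem exists_weighting_of_nearer (hdeg : ∀ v, G.degree v ≤ 5) (d : V → ℕ) (r : V)
    (T : Finset V) (hT : ∀ t ∈ T, 3 ≤ G.degree t) {w₀ : Sym2 V → ℕ} (hw₀ : ∀ e, w₀ e ∈ Icc 1 7)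
    (hT₀ : ∀ t ∈ T, ∃ a b, G.Adj t a ∧ G.Adj t b ∧ a ≠ r ∧ b ≠ r ∧ w₀ s(t, a) ≠ w₀ s(t, b))
    (P : Finset V) (hP : ∀ v ∈ P, ∃ p, G.Adj v p ∧ d p < d v) (hTP : Disjoint T P)
    (hr : T = ∅ ∨ r ∉ P) :
    ∃ w : Sym2 V → ℕ, (∀ e, w e ∈ Icc 1 7) ∧
      (∀ u ∈ P, ∀ v ∈ P, G.Adj u v → G.pairSum w u ≠ G.pairSum w v) ∧
      (∀ v ∈ P, 2 ≤ G.degree v → ∃ a b, G.Adj v a ∧ G.Adj v b ∧ w s(v, a) ≠ w s(v, b)) ∧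
      ∀ t ∈ T, ∃ a b, G.Adj t a ∧ G.Adj t b ∧ a ≠ r ∧ b ≠ r ∧ w s(t, a) ≠ w s(t, b) := by
  induction hn : P.card generalizing P with
  | zero =>
    obtain rfl := card_eq_zero.1 hn
    exact ⟨w₀, hw₀, by simp, by simp, hT₀⟩
  | succ n ih =>
    -- The nearest vertex is settled last. Its nearer neighbour `p` is then outside `P`, so
    -- reweighting `vp` leaves the rest of `P` untouched.
    obtain ⟨v, hv, hmin⟩ := P.exists_min_image d (card_pos.1 (by omega))
    obtain ⟨p, hvp, hdp⟩ := hP v hv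
    have hpP : p ∉ P := fun h => absurd (hmin p h) (by omega)
    have hvT : v ∉ T := fun h => Finset.disjoint_left.1 hTP h hv
    obtain ⟨w, hw, hsum, hmono, hTw⟩ := ih (P.erase v)
      (fun u hu => hP u (mem_of_mem_erase hu)) (hTP.mono_right (erase_subset _ _))
      (hr.imp_right fun h h' => h (mem_of_mem_erase h')) (by rw [card_erase_of_mem hv]; omega)
    obtain ⟨q, hq⟩ : ∃ q, 2 ≤ G.degree v → G.Adj v q ∧ q ≠ p := by
      by_cases h : 2 ≤ G.degree v
      · obtain ⟨q, hq⟩ := exists_ne_of_two_le_degree h p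
        exact ⟨q, fun _ => hq⟩
      · exact ⟨v, fun h' => absurd h' h⟩
    obtain ⟨z, hz⟩ : ∃ z, p ∈ T → G.Adj p z ∧ z ≠ v ∧ z ≠ r := by
      by_cases h : p ∈ T
      · obtain ⟨z, hz⟩ := exists_ne_ne_of_three_le_degree (hT p h) v r
        exact ⟨z, fun _ => hz⟩
      · exact ⟨v, fun h' => absurd h' h⟩
    -- At most 4 + 2 forbidden values among 7. Avoiding the weight of `vq` makes `v` non-constant;
    -- avoiding that of `pz` keeps a differing pair at `p` when `p ∈ T`.
    obtain ⟨x, hx, hxF⟩ := exists_mem_notMem_of_card_lt (s := Icc 1 7)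
      (t := ((G.neighborFinset v).erase p).image (fun u => G.pairSum w u -
        ∑ u ∈ (G.neighborFinset v).erase p, w s(v, u)) ∪ {w s(v, q), w s(p, z)}) (by
      have h1 := card_union_le (((G.neighborFinset v).erase p).image (fun u => G.pairSum w u -
        ∑ u ∈ (G.neighborFinset v).erase p, w s(v, u))) {w s(v, q), w s(p, z)}
      have h2 : ({w s(v, q), w s(p, z)} : Finset ℕ).card ≤ 2 := card_le_two
      have h3 : (((G.neighborFinset v).erase p).image (fun u => G.pairSum w u -
        ∑ u ∈ (G.neighborFinset v).erase p, w s(v, u))).card ≤ _ := card_image_le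
      rw [card_erase_of_mem ((G.mem_neighborFinset v p).2 hvp),
        G.card_neighborFinset_eq_degree] at h3
      have := hdeg v
      simp only [Nat.card_Icc]
      omega)
    simp only [mem_union, mem_insert, mem_singleton, not_or, mem_image, not_exists, not_and,
      mem_erase, mem_neighborFinset] at hxF
    obtain ⟨hxs, hxq, hxz⟩ := hxF
    set w' := Function.update w s(v, p) x with hw'
    have hoff : ∀ a b, a ≠ v → a ≠ p → w' s(a, b) = w s(a, b) := fun a b h1 h2 =>
      Function.update_of_ne (by simp [h1, h2]) _ _
    have hoff' : ∀ a b, b ≠ v → b ≠ p → w' s(a, b) = w s(a, b) := fun a b h1 h2 =>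
      Function.update_of_ne (by simp [h1, h2]) _ _
    have hvp' : w' s(v, p) = x := Function.update_self _ _ _
    have hpv' : w' s(p, v) = x := by rw [Sym2.eq_swap, hvp']
    have hP' : ∀ u ∈ P, u ≠ v → u ≠ p := fun u hu _ h => hpP (h ▸ hu)
    have hs : ∀ u ∈ P, u ≠ v → G.pairSum w' u = G.pairSum w u := fun u hu huv =>
      pairSum_congr fun b _ => hoff u b huv (hP' u hu huv)
    have hsv : G.pairSum w' v = x + ∑ u ∈ (G.neighborFinset v).erase p, w s(v, u) := by
      rw [pairSum_eq_add w' hvp, hvp']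
      congr 1
      refine sum_congr rfl fun u hu => ?_
      simp only [mem_erase, mem_neighborFinset] at hu
      exact hoff' v u hu.2.ne' hu.1
    have hnew : ∀ u ∈ P, G.Adj v u → G.pairSum w' u ≠ G.pairSum w' v := fun u hu hvu h => by
      rw [hs u hu hvu.ne', hsv] at h
      exact hxs u ⟨hP' u hu hvu.ne', hvu⟩ (by omega)
    refine ⟨w', fun e => ?_, fun u hu u' hu' huu' => ?_, fun u hu hdu => ?_, fun t ht => ?_⟩
    · by_cases he : e = s(v, p)
      · rw [he, hvp']; exact hx
      · rw [hw', Function.update_of_ne he]; exact hw e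
    · by_cases h : u = v
      · subst h
        exact (hnew u' hu' huu').symm
      by_cases h' : u' = v
      · subst h'
        exact hnew u hu huu'.symm
      rw [hs u hu h, hs u' hu' h']
      exact hsum u (mem_erase.2 ⟨h, hu⟩) u' (mem_erase.2 ⟨h', hu'⟩) huu'
    · by_cases h : u = v
      · subst h
        obtain ⟨huq, hqp⟩ := hq hdu
        exact ⟨p, q, hvp, huq, by rw [hvp', hoff' u q huq.ne' hqp]; exact hxq⟩
      · obtain ⟨a, b, ha, hb, hab⟩ := hmono u (mem_erase.2 ⟨h, hu⟩) hdu
        exact ⟨a, b, ha, hb, by rwa [hoff u a h (hP' u hu h), hoff u b h (hP' u hu h)]⟩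
    · have htv : t ≠ v := fun h => hvT (h ▸ ht)
      by_cases h : t = p
      · subst h
        obtain ⟨htz, hzv, hzr⟩ := hz ht
        have hvr : v ≠ r := fun h => hr.elim (fun h' => by simp [h'] at ht) (fun h' => h' (h ▸ hv))
        exact ⟨v, z, hvp.symm, htz, hvr, hzr, by
          rw [hpv', hoff' t z hzv htz.ne']; exact hxz⟩
      · obtain ⟨a, b, ha, hb, har, hbr, hab⟩ := hTw t ht
        exact ⟨a, b, ha, hb, har, hbr, by rwa [hoff t a htv h, hoff t b htv h]⟩

/-! ### Core a leaf -/

theorem exists_isGoodOn_of_degree_eq_one (hdeg : ∀ v, G.degree v ≤ 5) {r u : V}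
    (hr : G.degree r = 1) (hru : G.Adj r u) (hu : 2 ≤ G.degree u) : ∃ w, G.IsGoodOn r w := by
  classical
  obtain ⟨w, hw, hsum, hmono, -⟩ := exists_weighting_of_nearer hdeg (fun v => G.dist v r) r ∅
    (by simp) (w₀ := fun _ => 1) (by simp) (by simp)
    (univ.filter fun v => G.Reachable v r ∧ v ≠ r)
    (fun v hv => by simp only [mem_filter, mem_univ, true_and] at hv
                    exact hv.1.exists_adj_dist_lt hv.2)
    (by simp) (Or.inl rfl)
  simp only [mem_filter, mem_univ, true_and] at hsum hmono
  have key : ∀ v, G.Adj r v → G.pairSum w r < G.pairSum w v := fun v hrv => by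
    obtain rfl : v = u := by
      rw [← G.card_neighborFinset_eq_degree] at hr
      exact card_le_one.1 hr.le v (by simpa) u (by simpa)
    obtain ⟨q, hvq, hqr⟩ := exists_ne_of_two_le_degree hu r
    have h1 : (G.neighborFinset r).erase v = ∅ := by
      rw [← card_eq_zero, card_erase_of_mem (by simpa), G.card_neighborFinset_eq_degree, hr]
    have h2 : w s(v, q) ≤ ∑ u ∈ (G.neighborFinset v).erase r, w s(v, u) :=
      single_le_sum (f := fun u => w s(v, u)) (fun _ _ => Nat.zero_le _) (by simp [hqr, hvq])
    have h3 := (mem_Icc.1 (hw s(v, q))).1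
    rw [pairSum_eq_add w hrv, h1, sum_empty, pairSum_eq_add w hrv.symm, Sym2.eq_swap]
    omega
  refine ⟨w, hw, fun a b ha hab => ?_, fun v hv hd => ?_⟩
  · by_cases har : a = r
    · subst har
      exact (key b hab).ne
    by_cases hbr : b = r
    · subst hbr
      exact (key a hab.symm).ne'
    exact hsum a ⟨ha, har⟩ b ⟨hab.symm.reachable.trans ha, hbr⟩ hab
  · exact hmono v ⟨hv, fun h => by subst h; omega⟩ hd

end

/-! ### Core a triangle -/

section

variable {V : Type*} [Fintype V] {G : SimpleGraph V} [DecidableRel G.Adj]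

theorem IsGoodOn.of_reachable {r r' : V} {w : Sym2 V → ℕ} (h : G.IsGoodOn r w)
    (hr : G.Reachable r' r) : G.IsGoodOn r' w :=
  ⟨h.1, fun u v hu => h.2.1 u v (hu.trans hr), fun v hv => h.2.2 v (hv.trans hr)⟩

variable [DecidableEq V]

/-- If the edges at `v` all have the same weight, this determines the sum at `v` from the edges
other than `vp` and `vq`. -/
theorem exists_ne_weight_of_pairSum_ne {w : Sym2 V → ℕ} {v p q o : V} (hp : G.Adj v p)
    (hq : G.Adj v q) (hpq : p ≠ q) (h2 : G.degree v = 2 → w s(v, p) ≠ w s(v, q))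
    (ho : 3 ≤ G.degree v → G.Adj v o ∧ o ≠ p ∧ o ≠ q)
    (hne : 3 ≤ G.degree v → (G.pairSum w v : ZMod 7) ≠
      (∑ u ∈ ((G.neighborFinset v).erase p).erase q, w s(v, u) : ℕ) +
        ((w s(v, o) : ZMod 7) + w s(v, o))) :
    ∃ a b, G.Adj v a ∧ G.Adj v b ∧ w s(v, a) ≠ w s(v, b) := by
  by_cases hpq' : w s(v, p) = w s(v, q)
  · have h3 : 3 ≤ G.degree v := by
      have h1 : 1 < (G.neighborFinset v).card :=
        one_lt_card.2 ⟨p, by simpa using hp, q, by simpa using hq, hpq⟩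
      rw [G.card_neighborFinset_eq_degree] at h1
      have : G.degree v ≠ 2 := fun h => h2 h hpq'
      omega
    refine ⟨p, o, hp, (ho h3).1, fun h => hne h3 ?_⟩
    rw [pairSum_eq_add_add w hp hq hpq, ← hpq', h]
    push_cast
    ring
  · exact ⟨p, q, hp, hq, hpq'⟩

theorem exists_mem_Icc_cast_eq (x : ZMod 7) : ∃ n ∈ Icc 1 7, ((n : ℕ) : ZMod 7) = x := by
  revert x
  decide

/-- Taking `a` of least degree in the triangle matters: if `b` or `c` has degree two, so has `a`,
whose sum then has no outside neighbour to avoid, leaving room to force the triangle edges at `b`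
and `c` to differ. -/
theorem exists_isGoodOn_of_triangle (hdeg : ∀ v, G.degree v ≤ 5) {a b c : V} (hab : G.Adj a b)
    (hbc : G.Adj b c) (hac : G.Adj a c) (hb : G.degree a ≤ G.degree b)
    (hc : G.degree a ≤ G.degree c) : ∃ w, G.IsGoodOn a w := by
  obtain ⟨w, hw, hsum, hmono, -⟩ := exists_weighting_of_nearer hdeg (fun v => G.dist v a) a ∅
    (by simp) (w₀ := fun _ => 1) (by simp) (by simp)
    (univ.filter fun v => G.Reachable v a ∧ v ≠ a ∧ v ≠ b ∧ v ≠ c)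
    (fun v hv => by simp only [mem_filter, mem_univ, true_and] at hv
                    exact hv.1.exists_adj_dist_lt hv.2.1)
    (by simp) (Or.inl rfl)
  simp only [mem_filter, mem_univ, true_and] at hsum hmono
  have hba := hab.symm
  have hcb := hbc.symm
  have hca := hac.symm
  have hout : ∀ v p q : V, ∃ o, 3 ≤ G.degree v → G.Adj v o ∧ o ≠ p ∧ o ≠ q := fun v p q => by
    by_cases h : 3 ≤ G.degree v
    · obtain ⟨o, ho⟩ := exists_ne_ne_of_three_le_degree h p q
      exact ⟨o, fun _ => ho⟩
    · exact ⟨v, fun h' => absurd h' h⟩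
  have hcard : ∀ v p q : V, G.Adj v p → G.Adj v q → p ≠ q →
      (((G.neighborFinset v).erase p).erase q).card = G.degree v - 2 := fun v p q hp hq hpq => by
    rw [card_erase_of_mem (by simp [hpq.symm, hq]), card_erase_of_mem (by simpa),
      G.card_neighborFinset_eq_degree]
    omega
  have hdeg2 : ∀ v p q : V, G.Adj v p → G.Adj v q → p ≠ q → 2 ≤ G.degree v :=
    fun v p q hp hq hpq => by
      rw [← G.card_neighborFinset_eq_degree]
      exact one_lt_card.2 ⟨p, by simpa using hp, q, by simpa using hq, hpq⟩
  have ha2 := hdeg2 a b c hab hac hbc.ne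
  obtain ⟨ob, hob⟩ := hout b a c
  obtain ⟨oc, hoc⟩ := hout c b a
  set F : V → V → V → Finset (ZMod 7) := fun v p q =>
    (((G.neighborFinset v).erase p).erase q).image fun u => (G.pairSum w u : ZMod 7) with hF
  have hFcard : ∀ v p q : V, G.Adj v p → G.Adj v q → p ≠ q → (F v p q).card ≤ G.degree v - 2 :=
    fun v p q hp hq hpq => card_image_le.trans (hcard v p q hp hq hpq).le
  set B : V → V → V → ℕ := fun v p q =>
    ∑ u ∈ ((G.neighborFinset v).erase p).erase q, w s(v, u) with hB
  have hFa := hFcard a b c hab hac hbc.ne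
  have hFb := hFcard b a c hba hbc hac.ne
  have hFc := hFcard c b a hcb hca hba.ne
  have hda := hdeg a
  have hdb := hdeg b
  have hdc := hdeg c
  -- The value inserted at `b` (likewise at `c`) is the sum that would arise if both triangle edges
  -- there had the weight of a third edge; excluding it prevents constancy when the degree is at
  -- least three.
  obtain ⟨x, y, z, h1, h2, h3, h12, h13, h23, hxz, hxy, hyz⟩ :=
    exists_triangle_choice (B a b c) (B b a c) (B c b a) (F a b c)
      (insert ((B b a c : ZMod 7) + ((w s(b, ob) : ZMod 7) + w s(b, ob))) (F b a c))
      (insert ((B c b a : ZMod 7) + ((w s(c, oc) : ZMod 7) + w s(c, oc))) (F c b a))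
      (by omega) ((card_insert_le _ _).trans (by omega)) ((card_insert_le _ _).trans (by omega))
      (G.degree b = 2) (G.degree c = 2) (by
        by_cases h : G.degree a = 2
        · exact Or.inl (card_eq_zero.1 (by omega))
        · exact Or.inr ⟨by omega, by omega⟩)
  obtain ⟨x, hx, rfl⟩ := exists_mem_Icc_cast_eq x
  obtain ⟨y, hy, rfl⟩ := exists_mem_Icc_cast_eq y
  obtain ⟨z, hz, rfl⟩ := exists_mem_Icc_cast_eq z
  simp only [mem_insert, not_or] at h2 h3
  set w' : Sym2 V → ℕ := fun e => if e = s(a, b) then x else if e = s(b, c) then y else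
    if e = s(a, c) then z else w e with hw'
  have hoff : ∀ u v, v ≠ a → v ≠ b → v ≠ c → w' s(u, v) = w s(u, v) := fun u v h1 h2 h3 => by
    simp [hw', h1, h2, h3]
  have eab : w' s(a, b) = x := by simp [hw']
  have eba : w' s(b, a) = x := by rw [Sym2.eq_swap, eab]
  have ebc : w' s(b, c) = y := by simp [hw', hac.ne', hbc.ne', hba.ne]
  have ecb : w' s(c, b) = y := by rw [Sym2.eq_swap, ebc]
  have eac : w' s(a, c) = z := by simp [hw', hab.ne, hac.ne, hac.ne', hbc.ne']
  have eca : w' s(c, a) = z := by rw [Sym2.eq_swap, eac]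
  have hB' : ∀ v p q, v ∈ ({a, b, c} : Finset V) → p ∈ ({a, b, c} : Finset V) →
      q ∈ ({a, b, c} : Finset V) → v ≠ p → v ≠ q → p ≠ q →
      ∑ u ∈ ((G.neighborFinset v).erase p).erase q, w' s(v, u) = B v p q :=
    fun v p q hv hp hq hvp hvq hpq => sum_congr rfl fun u hu => by
      simp only [mem_erase, mem_neighborFinset] at hu
      have hvu := hu.2.2.ne
      simp only [mem_insert, mem_singleton] at hv hp hq
      apply hoff <;> grind
  have hBa := hB' a b c (by simp) (by simp) (by simp) hab.ne hac.ne hbc.ne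
  have hBb := hB' b a c (by simp) (by simp) (by simp) hba.ne hbc.ne hac.ne
  have hBc := hB' c b a (by simp) (by simp) (by simp) hcb.ne hca.ne hba.ne
  have hsa : (G.pairSum w' a : ZMod 7) = (B a b c : ZMod 7) + (x + z) := by
    rw [pairSum_eq_add_add w' hab hac hbc.ne, hBa, eab, eac]; push_cast; ring
  have hsb : (G.pairSum w' b : ZMod 7) = (B b a c : ZMod 7) + (x + y) := by
    rw [pairSum_eq_add_add w' hba hbc hac.ne, hBb, eba, ebc]; push_cast; ring
  have hsc : (G.pairSum w' c : ZMod 7) = (B c b a : ZMod 7) + (y + z) := by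
    rw [pairSum_eq_add_add w' hcb hca hba.ne, hBc, ecb, eca]; push_cast; ring
  have hso : ∀ v, v ≠ a → v ≠ b → v ≠ c → G.pairSum w' v = G.pairSum w v := fun v h1 h2 h3 =>
    pairSum_congr fun u _ => by rw [Sym2.eq_swap, hoff u v h1 h2 h3, Sym2.eq_swap]
  have hcore : ∀ v p q u, (G.pairSum w' v : ZMod 7) ∉ F v p q → G.Adj v u → u ≠ p → u ≠ q →
      u ≠ a → u ≠ b → u ≠ c → G.pairSum w' v ≠ G.pairSum w' u :=
    fun v p q u hv hvu hp hq h1 h2 h3 h => hv (by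
      rw [h, hso u h1 h2 h3]
      exact mem_image_of_mem _ (by simp [hp, hq, hvu]))
  rw [← hsa] at h1 h12 h13
  rw [← hsb] at h2 h12 h23
  rw [← hsc] at h3 h13 h23
  have hcast : ∀ u v : V, (G.pairSum w' u : ZMod 7) ≠ G.pairSum w' v →
      G.pairSum w' u ≠ G.pairSum w' v := fun u v h h' => h (by rw [h'])
  have hkey : ∀ v u, v = a ∨ v = b ∨ v = c → G.Adj v u → G.pairSum w' v ≠ G.pairSum w' u := by
    intro v u hv hvu
    by_cases hu : u = a ∨ u = b ∨ u = c
    · rcases hv with rfl | rfl | rfl <;> rcases hu with rfl | rfl | rfl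
      · exact absurd rfl hvu.ne
      · exact hcast _ _ h12
      · exact hcast _ _ h13
      · exact hcast _ _ h12.symm
      · exact absurd rfl hvu.ne
      · exact hcast _ _ h23
      · exact hcast _ _ h13.symm
      · exact hcast _ _ h23.symm
      · exact absurd rfl hvu.ne
    · simp only [not_or] at hu
      rcases hv with rfl | rfl | rfl
      · exact hcore _ b c u h1 hvu hu.2.1 hu.2.2 hu.1 hu.2.1 hu.2.2
      · exact hcore _ a c u h2.2 hvu hu.1 hu.2.2 hu.1 hu.2.1 hu.2.2
      · exact hcore _ b a u h3.2 hvu hu.2.1 hu.1 hu.1 hu.2.1 hu.2.2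
  refine ⟨w', fun e => ?_, fun u v hu huv => ?_, fun v hv hd => ?_⟩
  · simp only [hw']
    split_ifs
    exacts [hx, hy, hz, hw e]
  · by_cases hu' : u = a ∨ u = b ∨ u = c
    · exact hkey u v hu' huv
    by_cases hv' : v = a ∨ v = b ∨ v = c
    · exact (hkey v u hv' huv.symm).symm
    simp only [not_or] at hu' hv'
    rw [hso u hu'.1 hu'.2.1 hu'.2.2, hso v hv'.1 hv'.2.1 hv'.2.2]
    exact hsum u ⟨hu, hu'⟩ v ⟨huv.symm.reachable.trans hu, hv'⟩ huv
  · by_cases hva : v = a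
    · subst hva
      exact ⟨b, c, hab, hac, by rw [eab, eac]; exact fun h => hxz (by rw [h])⟩
    by_cases hvb : v = b
    · subst hvb
      refine exists_ne_weight_of_pairSum_ne hba hbc hac.ne
        (fun h => by rw [eba, ebc]; exact fun h' => hxy h (by rw [h'])) hob ?_
      intro h
      rw [hBb, hoff v ob (hob h).2.1 (hob h).1.ne' (hob h).2.2]
      exact h2.1
    by_cases hvc : v = c
    · subst hvc
      refine exists_ne_weight_of_pairSum_ne hcb hca hba.ne
        (fun h => by rw [ecb, eca]; exact fun h' => hyz h (by rw [h'])) hoc ?_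
      intro h
      rw [hBc, hoff v oc (hoc h).2.2 (hoc h).2.1 (hoc h).1.ne']
      exact h3.1
    obtain ⟨p, q, hp, hq, hpq⟩ := hmono v ⟨hv, hva, hvb, hvc⟩ hd
    refine ⟨p, q, hp, hq, ?_⟩
    rwa [Sym2.eq_swap, hoff p v hva hvb hvc, Sym2.eq_swap, Sym2.eq_swap (a := v) (b := q),
      hoff q v hva hvb hvc, Sym2.eq_swap (a := q)]

end

/-! ### Core a star -/

section

variable {V : Type*} [Fintype V] [DecidableEq V] {G : SimpleGraph V} [DecidableRel G.Adj]

/-- Neighbours of `r` of degree at least three keep a differing pair of edges away from `r`,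
whatever the star weights. Those of degree two instead avoid the weight of their other edge. -/
theorem exists_isGoodOn_of_star (hdeg : ∀ v, G.degree v ≤ 5) {r : V}
    (hleaf : ∀ v, G.Reachable v r → 2 ≤ G.degree v)
    (htri : ∀ u v, G.Adj r u → G.Adj r v → ¬ G.Adj u v) : ∃ w, G.IsGoodOn r w := by
  have hz : ∀ u, ∃ z, 3 ≤ G.degree u → G.Adj u z ∧ z ≠ r := fun u => by
    by_cases h : 3 ≤ G.degree u
    · obtain ⟨z, hz⟩ := exists_ne_of_two_le_degree (by omega : 2 ≤ G.degree u) r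
      exact ⟨z, fun _ => hz⟩
    · exact ⟨u, fun h' => absurd h' h⟩
  choose z hz using hz
  classical
  obtain ⟨w, hw, hsum, hmono, hT⟩ := exists_weighting_of_nearer hdeg (fun v => G.dist v r) r
    (univ.filter fun u => G.Adj r u ∧ 3 ≤ G.degree u) (by simp)
    -- One marked edge `u z(u)` per neighbour `u` of `r`. Any other edge from `u` to a vertex other
    -- than `r` is unmarked: otherwise its far end would be adjacent to `r`, giving a triangle.
    (w₀ := fun e => if ∃ u, G.Adj r u ∧ e = s(u, z u) then 2 else 1)
    (fun e => by split_ifs <;> simp)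
    (fun t ht => by
      simp only [mem_filter, mem_univ, true_and] at ht
      obtain ⟨htz, hzr⟩ := hz t ht.2
      obtain ⟨b, htb, hbz, hbr⟩ := exists_ne_ne_of_three_le_degree ht.2 (z t) r
      refine ⟨z t, b, htz, htb, hzr, hbr, ?_⟩
      rw [if_pos ⟨t, ht.1, rfl⟩, if_neg]
      · norm_num
      · rintro ⟨u, hru, he⟩
        rcases Sym2.eq_iff.1 he with ⟨rfl, h⟩ | ⟨h, rfl⟩
        · exact hbz h
        · exact htri t b ht.1 hru htb)
    (univ.filter fun v => G.Reachable v r ∧ v ≠ r ∧ ¬ G.Adj r v)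
    (fun v hv => by simp only [mem_filter, mem_univ, true_and] at hv
                    exact hv.1.exists_adj_dist_lt hv.2.1)
    (Finset.disjoint_left.2 fun v h h' => by
      simp only [mem_filter, mem_univ, true_and] at h h'
      exact h'.2.2 h.1)
    (by simp)
  simp only [mem_filter, mem_univ, true_and] at hsum hmono hT
  have ho : ∀ u, ∃ o, 2 ≤ G.degree u → G.Adj u o ∧ o ≠ r := fun u => by
    by_cases h : 2 ≤ G.degree u
    · obtain ⟨z, hz⟩ := exists_ne_of_two_le_degree h r
      exact ⟨z, fun _ => hz⟩
    · exact ⟨u, fun h' => absurd h' h⟩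
  choose o ho using ho
  set B : V → ℕ := fun u => ∑ v ∈ (G.neighborFinset u).erase r, w s(u, v) with hB
  -- A neighbour of degree two loses at most 1 + 1 weights and any other at most 4, so at least
  -- three of seven remain.
  obtain ⟨f, hfL, hfs, i, hi, j, hj, hij⟩ := exists_star_choice (G.neighborFinset r)
    (by rw [G.card_neighborFinset_eq_degree]; exact hleaf r (Reachable.refl r))
    (by rw [G.card_neighborFinset_eq_degree]; exact hdeg r)
    (fun u => Icc 1 7 \ (((G.neighborFinset u).erase r).image (fun v => G.pairSum w v - B u) ∪
      if G.degree u = 2 then {w s(u, o u)} else ∅))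
    (fun u hu => by
      rw [mem_neighborFinset] at hu
      have h1 : (((G.neighborFinset u).erase r).image (fun v => G.pairSum w v - B u)).card ≤ _ :=
        card_image_le
      rw [card_erase_of_mem (by simpa using hu.symm), G.card_neighborFinset_eq_degree] at h1
      have h2 := card_union_le
        (((G.neighborFinset u).erase r).image (fun v => G.pairSum w v - B u))
        (if G.degree u = 2 then {w s(u, o u)} else ∅)
      have h3 : (if G.degree u = 2 then {w s(u, o u)} else ∅ : Finset ℕ).card ≤
          if G.degree u = 2 then 1 else 0 := by split_ifs <;> simp
      have h4 := le_card_sdiff (((G.neighborFinset u).erase r).image (fun v => G.pairSum w v - B u)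
        ∪ if G.degree u = 2 then {w s(u, o u)} else ∅) (Icc 1 7)
      rw [Nat.card_Icc] at h4
      have := hdeg u
      split_ifs at * <;> omega)
    B
  simp only [mem_neighborFinset, mem_sdiff, mem_union, not_or, mem_image, mem_erase, not_exists,
    not_and] at hfL hfs hi hj
  set g : V → ℕ := fun v => if G.Adj r v then f v else 1 with hg
  have hg' : ∀ u, G.Adj r u → g u = f u := fun u hu => if_pos hu
  have hgI : ∀ u, g u ∈ Icc 1 7 := fun u => by
    by_cases hu : G.Adj r u
    · rw [hg' u hu]; exact (hfL u hu).1
    · simp [hg, hu]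
  set w' : Sym2 V → ℕ := Sym2.lift ⟨fun a b => if a = r then g b else if b = r then g a else
    w s(a, b), fun a b => by
      dsimp only
      rw [Sym2.eq_swap]
      split_ifs with h1 h2 <;> simp [*]⟩ with hw'
  have hwr : ∀ u, w' s(r, u) = g u := fun u => by simp [hw']
  have hwr' : ∀ u, w' s(u, r) = g u := fun u => by rw [Sym2.eq_swap, hwr]
  have hoff : ∀ u v, u ≠ r → v ≠ r → w' s(u, v) = w s(u, v) := fun u v hu hv => by
    simp [hw', hu, hv]
  have hsr : G.pairSum w' r = ∑ v ∈ G.neighborFinset r, f v :=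
    sum_congr rfl fun u hu => by rw [hwr, hg' u (by simpa using hu)]
  have hsu : ∀ u, G.Adj r u → G.pairSum w' u = B u + f u := fun u hu => by
    rw [pairSum_eq_add w' hu.symm, hwr', hg' u hu, add_comm]
    congr 1
    refine sum_congr rfl fun v hv => ?_
    simp only [mem_erase] at hv
    exact hoff u v hu.ne' hv.1
  have hso : ∀ v, v ≠ r → ¬ G.Adj r v → G.pairSum w' v = G.pairSum w v := fun v hv hrv =>
    pairSum_congr fun u hu => hoff v u hv (by rintro rfl; exact hrv hu.symm)
  have hr1 : ∀ u, G.Adj r u → G.pairSum w' r ≠ G.pairSum w' u := fun u hu => by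
    rw [hsr, hsu u hu]; exact hfs u hu
  have hr2 : ∀ u v, G.Adj r u → G.Adj u v → G.pairSum w' u ≠ G.pairSum w' v := by
    intro u v hu huv
    by_cases hvr : v = r
    · subst hvr
      exact (hr1 u hu).symm
    · have hrv : ¬ G.Adj r v := fun h => htri u v hu h huv
      rw [hsu u hu, hso v hvr hrv]
      intro h
      exact (hfL u hu).2.1 v ⟨hvr, huv⟩ (by omega)
  refine ⟨w', fun e => ?_, fun u v hu huv => ?_, fun v hv hd => ?_⟩
  · induction e with | _ a b
    by_cases ha : a = r
    · rw [ha, hwr]; exact hgI b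
    by_cases hb : b = r
    · rw [hb, hwr']; exact hgI a
    rw [hoff a b ha hb]
    exact hw _
  · by_cases hur : u = r
    · subst hur
      exact hr1 v huv
    by_cases hvr : v = r
    · subst hvr
      exact (hr1 u huv.symm).symm
    by_cases hru : G.Adj r u
    · exact hr2 u v hru huv
    by_cases hrv : G.Adj r v
    · exact (hr2 v u hrv huv.symm).symm
    rw [hso u hur hru, hso v hvr hrv]
    exact hsum u ⟨hu, hur, hru⟩ v ⟨huv.symm.reachable.trans hu, hvr, hrv⟩ huv
  · by_cases hvr : v = r
    · subst hvr
      exact ⟨i, j, hi, hj, by rwa [hwr, hwr, hg' i hi, hg' j hj]⟩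
    by_cases hrv : G.Adj r v
    · by_cases hd3 : 3 ≤ G.degree v
      · obtain ⟨a, b, ha, hb, har, hbr, hab⟩ := hT v ⟨hrv, hd3⟩
        exact ⟨a, b, ha, hb, by rwa [hoff v a hvr har, hoff v b hvr hbr]⟩
      · obtain ⟨hvo, hor⟩ := ho v hd
        refine ⟨r, o v, hrv.symm, hvo, ?_⟩
        rw [hwr', hg' v hrv, hoff v _ hvr hor]
        have := (hfL v hrv).2.2
        rw [if_pos (by omega)] at this
        simpa using this
    · obtain ⟨a, b, ha, hb, hab⟩ := hmono v ⟨hv, hvr, hrv⟩ hd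
      have hne : ∀ a, G.Adj v a → a ≠ r := fun a h h' => hrv (h' ▸ h.symm)
      exact ⟨a, b, ha, hb, by rwa [hoff v a hvr (hne a ha), hoff v b hvr (hne b hb)]⟩

/-! ### Nice graphs: choosing a core and gluing components -/

/-- In a nice graph, the neighbour of a vertex of degree one has degree at least two. -/
theorem IsNice.two_le_degree (hG : G.IsNice) {r u : V} (hr : G.degree r = 1) (hru : G.Adj r u) :
    2 ≤ G.degree u := by
  by_contra hu
  have hu1 : G.degree u ≤ 1 := by omega
  have hru' : ∀ v, G.Adj r v → v = u := fun v hv =>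
    card_le_one.1 ((G.card_neighborFinset_eq_degree r).trans hr).le v (by simpa) u (by simpa)
  have hur' : ∀ v, G.Adj u v → v = r := fun v hv =>
    card_le_one.1 ((G.card_neighborFinset_eq_degree u).trans_le hu1) v (by simpa) r
      (by simpa using hru.symm)
  have hwalk : ∀ {a b : V}, G.Walk a b → a = r ∨ a = u → b = r ∨ b = u := by
    intro a b W
    induction W with
    | nil => exact id
    | cons h _ ih =>
      rintro (rfl | rfl)
      · exact ih (Or.inr (hru' _ h))
      · exact ih (Or.inl (hur' _ h))
  have hmem : ∀ v, v ∈ (G.connectedComponentMk r).supp ↔ v = r ∨ v = u := fun v => by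
    rw [ConnectedComponent.mem_supp_iff, ConnectedComponent.eq]
    constructor
    · rintro ⟨W⟩
      exact hwalk W.reverse (Or.inl rfl)
    · rintro (rfl | rfl)
      · exact Reachable.refl v
      · exact hru.symm.reachable
  have hne : u ≠ r := hru.ne'
  refine (hG (G.connectedComponentMk r)).false ⟨⟨fun v => if v.1 = r then 0 else 1,
    fun i => if i = 0 then ⟨r, (hmem r).2 (Or.inl rfl)⟩ else ⟨u, (hmem u).2 (Or.inr rfl)⟩,
    fun v => ?_, fun i => ?_⟩, fun {v v'} => ?_⟩
  · rcases (hmem v.1).1 v.2 with h | h <;> ext <;> simp [h, hne]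
  · fin_cases i <;> simp [hne]
  · have hadj : (G.connectedComponentMk r).toSimpleGraph.Adj v v' ↔ G.Adj v.1 v'.1 := Iff.rfl
    rw [hadj]
    rcases (hmem v.1).1 v.2 with h | h <;> rcases (hmem v'.1).1 v'.2 with h' | h' <;>
    simp [h, h', hne, hru, hru.symm]

theorem IsNice.exists_isGoodOn (hG : G.IsNice) (hdeg : ∀ v, G.degree v ≤ 5) (r : V) :
    ∃ w, G.IsGoodOn r w := by
  by_cases hleaf : ∃ v, G.Reachable v r ∧ G.degree v = 1
  · obtain ⟨v, hv, hv1⟩ := hleaf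
    obtain ⟨u, hu⟩ : ∃ u, G.Adj v u := (G.degree_pos_iff_exists_adj v).1 (by omega)
    obtain ⟨w, hw⟩ := exists_isGoodOn_of_degree_eq_one hdeg hv1 hu (hG.two_le_degree hv1 hu)
    exact ⟨w, hw.of_reachable hv.symm⟩
  by_cases htri : ∃ a b c, G.Reachable r a ∧ G.Adj a b ∧ G.Adj b c ∧ G.Adj a c
  · obtain ⟨a, b, c, hra, hab, hbc, hac⟩ := htri
    have hrb := hra.trans hab.reachable
    have hrc := hra.trans hac.reachable
    by_cases h1 : G.degree a ≤ G.degree b ∧ G.degree a ≤ G.degree c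
    · obtain ⟨w, hw⟩ := exists_isGoodOn_of_triangle hdeg hab hbc hac h1.1 h1.2
      exact ⟨w, hw.of_reachable hra⟩
    by_cases h2 : G.degree b ≤ G.degree a ∧ G.degree b ≤ G.degree c
    · obtain ⟨w, hw⟩ := exists_isGoodOn_of_triangle hdeg hab.symm hac hbc h2.1 h2.2
      exact ⟨w, hw.of_reachable hrb⟩
    · obtain ⟨w, hw⟩ := exists_isGoodOn_of_triangle hdeg hac.symm hab hbc.symm
        (by omega) (by omega)
      exact ⟨w, hw.of_reachable hrc⟩
  by_cases hr0 : G.degree r = 0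
  · have honly : ∀ v, G.Reachable v r → v = r := fun v hv => by
      by_contra hne
      obtain ⟨p, hp, -⟩ := hv.symm.exists_adj_dist_lt (Ne.symm hne)
      exact absurd ((G.degree_pos_iff_exists_adj r).2 ⟨p, hp⟩) (by omega)
    refine ⟨fun _ => 1, by simp, fun u v hu huv => ?_, fun v hv hd => ?_⟩
    · have := (G.degree_pos_iff_exists_adj u).2 ⟨v, huv⟩
      rw [honly u hu] at this
      omega
    · rw [honly v hv] at hd
      omega
  · refine exists_isGoodOn_of_star hdeg (fun v hv => ?_) fun u v hu hv huv =>
      htri ⟨r, u, v, Reachable.refl r, hu, huv, hv⟩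
    have h1 : G.degree v ≠ 1 := fun h => hleaf ⟨v, hv, h⟩
    have h0 : G.degree v ≠ 0 := fun h => by
      by_cases hvr : v = r
      · exact hr0 (hvr ▸ h)
      · obtain ⟨p, hp, -⟩ := hv.exists_adj_dist_lt hvr
        exact absurd ((G.degree_pos_iff_exists_adj v).2 ⟨p, hp⟩) (by omega)
    omega

/-- A nice graph of maximum degree at most five has a weighting with weights `1, …, 7` that
distinguishes neighbours by sums and is not constant around any vertex of degree at least two. -/
theorem IsNice.exists_weighting (hG : G.IsNice) (hdeg : ∀ v, G.degree v ≤ 5) :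
    ∃ w : Sym2 V → ℕ, (∀ e, w e ∈ Icc 1 7) ∧
      (∀ u v, G.Adj u v → G.pairSum w u ≠ G.pairSum w v) ∧
      ∀ v, 2 ≤ G.degree v → ∃ a b, G.Adj v a ∧ G.Adj v b ∧ w s(v, a) ≠ w s(v, b) := by
  choose W hW using hG.exists_isGoodOn hdeg
  set root : V → V := fun v => (G.connectedComponentMk v).out with hroot
  have hreach : ∀ v, G.Reachable v (root v) := fun v =>
    ConnectedComponent.exact (Quot.out_eq (G.connectedComponentMk v)).symm
  have hadj : ∀ u v, G.Adj u v → root u = root v := fun u v h => by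
    simp only [hroot, ConnectedComponent.sound h.reachable]
  -- Either end of an edge gives the same root, so the arbitrary representative is immaterial.
  set w : Sym2 V → ℕ := fun e => W (root e.out.1) e with hw
  have hwW : ∀ u v, G.Adj u v → w s(u, v) = W (root u) s(u, v) := fun u v h => by
    have hmem : (s(u, v) : Sym2 V).out.1 ∈ s(u, v) := Sym2.out_fst_mem _
    rcases Sym2.mem_iff.1 hmem with h' | h'
    · simp only [hw, h']
    · simp only [hw, h', hadj u v h]
  have hs : ∀ v, G.pairSum w v = G.pairSum (W (root v)) v := fun v => pairSum_congr (hwW v)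
  refine ⟨w, fun e => (hW _).1 e, fun u v huv => ?_, fun v hv => ?_⟩
  · rw [hs, hs, ← hadj u v huv]
    exact (hW _).2.1 u v (hreach u) huv
  · obtain ⟨a, b, ha, hb, hab⟩ := (hW _).2.2 v (hreach v) hv
    exact ⟨a, b, ha, hb, by rwa [hwW v a ha, hwW v b hb]⟩

/-- A single weight class cannot contain two edges of different weights, so it misses an edge at
each vertex of degree at least two. At a vertex of degree one, niceness gives a neighbour of degree
at least two, so the bound is at least one. -/
theorem IsNice.isRelaxed (hG : G.IsNice) {ω : G.edgeSet → ℕ}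
    (h : ∀ v, 2 ≤ G.degree v →
      ∃ e f : G.edgeSet, v ∈ (e : Sym2 V) ∧ v ∈ (f : Sym2 V) ∧ ω e ≠ ω f) :
    G.IsRelaxed (G.maxDegree - 1) ω := by
  intro S hS v
  set H := fromEdgeSet ((fun e : G.edgeSet => (e : Sym2 V)) '' S) with hH
  have hHS : ∀ e : G.edgeSet, (e : Sym2 V) ∈ H.edgeSet → e ∈ S := fun e he => by
    rw [hH, edgeSet_fromEdgeSet] at he
    obtain ⟨⟨e', he', h⟩, -⟩ := he
    rwa [← Subtype.ext h]
  have hsub : H.neighborSet v ⊆ G.neighborSet v := fun u hu => by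
    obtain ⟨⟨e, -, he⟩, -⟩ := (fromEdgeSet_adj _).1 hu
    exact G.mem_edgeSet.1 (he ▸ e.2)
  have hcard : (G.neighborSet v).ncard = G.degree v := by
    rw [Set.ncard_eq_toFinset_card', ← G.card_neighborFinset_eq_degree]; rfl
  have hle := Set.ncard_le_ncard hsub
  have hmax := G.degree_le_maxDegree v
  by_cases hv : 2 ≤ G.degree v
  · obtain ⟨e, f, hve, hvf, hef⟩ := h v hv
    have hlt : (H.neighborSet v).ncard < (G.neighborSet v).ncard := by
      refine Set.ncard_lt_ncard (hsub.ssubset_of_ne fun heq => hef ?_)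
      have hall : ∀ e : G.edgeSet, v ∈ (e : Sym2 V) → e ∈ S := fun e he => by
        obtain ⟨u, hu⟩ := Sym2.mem_iff_exists.1 he
        refine hHS e ?_
        have hadj : G.Adj v u := G.mem_edgeSet.1 (hu ▸ e.2)
        rw [hu]
        exact (heq ▸ hadj : u ∈ H.neighborSet v)
      exact hS e (hall e hve) f (hall f hvf)
    omega
  · by_cases hv0 : G.degree v = 0
    · omega
    · obtain ⟨u, hu⟩ := (G.degree_pos_iff_exists_adj v).1 (by omega)
      have := hG.two_le_degree (by omega : G.degree v = 1) hu
      have := G.degree_le_maxDegree u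
      omega

end

end SimpleGraph

end

theorem mainTheorem3 {V : Type*} [Fintype V] (G : SimpleGraph V) [DecidableRel G.Adj]
    (hnice : G.IsNice) (hdeg : G.maxDegree ≤ 5) :
    (∃ ω : G.edgeSet → ℕ, G.IsEdgeWeighting 7 ω ∧ G.IsNeighbourSumDistinguishing ω ∧
      ∀ v, 2 ≤ G.degree v →
        ∃ e f : G.edgeSet, v ∈ (e : Sym2 V) ∧ v ∈ (f : Sym2 V) ∧ ω e ≠ ω f) ∧
    G.relaxedSumIndex (G.maxDegree - 1) ≤ 7 := by
  classical
  obtain ⟨w, hw, hsum, hmono⟩ :=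
    hnice.exists_weighting fun v => (G.degree_le_maxDegree v).trans hdeg
  have h1 : G.IsEdgeWeighting 7 (fun e => w e) := fun e => Finset.mem_Icc.1 (hw e)
  have h2 : G.IsNeighbourSumDistinguishing (fun e => w e) := fun u v huv => by
    rw [SimpleGraph.weightSum_eq_pairSum, SimpleGraph.weightSum_eq_pairSum]
    exact hsum u v huv
  have h3 : ∀ v, 2 ≤ G.degree v →
      ∃ e f : G.edgeSet, v ∈ (e : Sym2 V) ∧ v ∈ (f : Sym2 V) ∧ w e ≠ w f := fun v hv => by
    obtain ⟨a, b, ha, hb, hab⟩ := hmono v hv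
    exact ⟨⟨s(v, a), ha⟩, ⟨s(v, b), hb⟩, by simp, by simp, hab⟩
  exact ⟨⟨_, h1, h2, h3⟩, sInf_le ⟨7, rfl, by norm_num, _, h1, hnice.isRelaxed h3, h2⟩⟩
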